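/- For integers $n\ge 1$ and $1\le k<p$ and real $\sigma>0$, consider the linear model $y=X\beta+z$, where $X\in\mathbb R^{n\times p}$ has i.i.d. rows $x_i\sim\mathcal N(0,I_p)$, $z\sim\mathcal N(0,\sigma^2I_n)$ is independent of $X$, and $\beta\in\Theta_k:=\{\beta\in\mathbb R^p:\ \beta\text{ has at most }k\text{ non-zero components}\}$. Fix $\varepsilon\in(0,1)$ and put $$\lambda_\varepsilon=(1+\varepsilon)\,\sigma\sqrt{\frac{2\log(p/k)}{n}},\qquad \delta_0=\Big(1+\frac\varepsilon2\Big)^{1/3}-1,\qquad c_0=8\sqrt2\,\varepsilon^{-1}\Big(1+\frac\varepsilon2\Big)^{2/3}+2\varepsilon^{-1}+2 .$$ Let $\hat\beta^L=\hat\beta^L(X,y)$ be a Lasso estimator with tuning parameter $\lambda_\varepsilon$, i.e. any measurable selection of $$\hat\beta^L\in\operatorname*{argmin}_{b\in\mathbb R^p}\ \frac1{2n}\|y-Xb\|_2^2+\lambda_\varepsilon\|b\|_1 .$$ Let $X_j$ denote the $j$-th column of $X$, let $$\theta(k,c_0)=\inf\Big\{\frac{\|X\delta\|_2}{\sqrt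 n\,\|\delta\|_2}:\ \delta\in\mathbb R^p\setminus\{0\},\ \|\delta\|_1\le(1+c_0)\sqrt k\,\|\delta\|_2\Big\},$$ and let $\mathcal A$ be the event that $\max_{1\le j\le p}\|X_j\|_2\le(1+\delta_0)\sqrt n$ and $\theta(k,c_0)\ge 1-\delta_0$. **Proposition 4.6.** Consider any sequence of such problems $(n_m,p_m,k_m,\sigma_m)_{m\in\mathbb N}$ with $k_m/p_m\to0$, and a Lasso estimator as above for each $m$, with the same $\varepsilon$. Then for every real $q\ge2$, $$\Big(\sup_{\beta\in\Theta_k}\mathbb E\big(\|\hat\beta^L-\beta\|_2^q\,\mathbb 1_{\mathcal A}\big)\Big)^{2/q}=O\Big(\frac{\sigma^2k\log(p/k)}{n}\Big)$$ along the sequence; that is, there is a finite constant $C$ such that for every $m$ the left-hand side is at most $C\sigma^2k\log(p/k)/n$, where $n=n_m$, $p=p_m$, $k=k_m$, $\sigma=\sigma_m$. -/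

import Mathlib

open Filter Topology MeasureTheory ProbabilityTheory
open scoped ENNReal Matrix

noncomputable section

namespace SparseLasso

/-- The entrywise (product) σ-algebra on real matrices. -/
instance matrixMeasurableSpace (n p : ℕ) : MeasurableSpace (Matrix (Fin n) (Fin p) ℝ) :=
  inferInstanceAs (MeasurableSpace (Fin n → Fin p → ℝ))

/-- The `ℓ₁` norm `∑ⱼ |vⱼ|` of a real vector. -/
def norm1 {d : ℕ} (v : Fin d → ℝ) : ℝ := ∑ j, |v j|

/-- The Euclidean norm `√(∑ⱼ vⱼ²)` of a real vector. -/
def norm2 {d : ℕ} (v : Fin d → ℝ) : ℝ := ‖WithLp.toLp 2 v‖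

/-- The `k`-sparse vectors: at most `k` non-zero components. -/
def Theta (p k : ℕ) : Set (Fin p → ℝ) := {β | (Function.support β).ncard ≤ k}

/-- The cone `{δ : ‖δ‖₁ ≤ (1 + c₀) √k ‖δ‖₂}`. -/
def sreCone (p k : ℕ) (c₀ : ℝ) : Set (Fin p → ℝ) :=
  {δ | norm1 δ ≤ (1 + c₀) * √(k : ℝ) * norm2 δ}

/-- The constant `θ(k, c₀)` of the design `X`: the infimum of `‖Xδ‖₂ / (√n ‖δ‖₂)` over the non-zero
vectors `δ` of the cone. -/
def sreConstant {n p : ℕ} (X : Matrix (Fin n) (Fin p) ℝ) (k : ℕ) (c₀ : ℝ) : ℝ :=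
  sInf ((fun δ : Fin p → ℝ => norm2 (X *ᵥ δ) / (√(n : ℝ) * norm2 δ)) '' (sreCone p k c₀ \ {0}))

/-- The event `𝒜(δ₀, c₀, k)`: all columns of `X` have Euclidean norm at most `(1 + δ₀) √n`, and
`θ(k, c₀) ≥ 1 - δ₀`. -/
def goodDesign (n p k : ℕ) (δ₀ c₀ : ℝ) : Set (Matrix (Fin n) (Fin p) ℝ) :=
  {X | (∀ j, norm2 (X.col j) ≤ (1 + δ₀) * √(n : ℝ)) ∧ 1 - δ₀ ≤ sreConstant X k c₀}

/-- The Lasso objective `(1 / 2n) ‖y - Xb‖₂² + lam ‖b‖₁`. -/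
def lassoObjective {n p : ℕ} (lam : ℝ) (X : Matrix (Fin n) (Fin p) ℝ) (y : Fin n → ℝ)
    (b : Fin p → ℝ) : ℝ :=
  1 / (2 * (n : ℝ)) * norm2 (y - X *ᵥ b) ^ 2 + lam * norm1 b

/-- `est` is a Lasso estimator: a measurable function of the data `(X, y)` that selects a minimizer
of the Lasso objective. -/
structure IsLassoEstimator {n p : ℕ} (lam : ℝ)
    (est : Matrix (Fin n) (Fin p) ℝ → (Fin n → ℝ) → Fin p → ℝ) : Prop where
  measurable : Measurable fun d : Matrix (Fin n) (Fin p) ℝ × (Fin n → ℝ) => est d.1 d.2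
  isMinOn : ∀ X y, IsMinOn (lassoObjective lam X y) Set.univ (est X y)

/-- The tuning parameter `λ_ε = (1 + ε) σ √(2 log(p/k) / n)`. -/
def lamEps (n p k : ℕ) (σ ε : ℝ) : ℝ :=
  (1 + ε) * σ * √(2 * Real.log ((p : ℝ) / k) / n)

/-- `δ₀ = (1 + ε/2)^{1/3} - 1`. -/
def delta0 (ε : ℝ) : ℝ := (1 + ε / 2) ^ (1 / 3 : ℝ) - 1

/-- `c₀ = 8√2 ε⁻¹ (1 + ε/2)^{2/3} + 2 ε⁻¹ + 2`. -/
def c0 (ε : ℝ) : ℝ := 8 * √2 * ε⁻¹ * (1 + ε / 2) ^ (2 / 3 : ℝ) + 2 * ε⁻¹ + 2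

/-- The law of the isotropic Gaussian design: `n` i.i.d. rows distributed as `N(0, I_p)`, that is,
i.i.d. standard normal entries. -/
def designLaw (n p : ℕ) : Measure (Matrix (Fin n) (Fin p) ℝ) :=
  Measure.pi fun _ : Fin n => Measure.pi fun _ : Fin p => gaussianReal 0 1

/-- The law of the noise: `n` i.i.d. `N(0, σ²)` variables. -/
def noiseLaw (n : ℕ) (σ : ℝ) : Measure (Fin n → ℝ) :=
  Measure.pi fun _ : Fin n => gaussianReal 0 ⟨σ ^ 2, sq_nonneg σ⟩

/-- `E (‖est - β‖₂^q 1_A)` in the model `y = Xβ + z` with isotropic Gaussian design `X` and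
independent Gaussian noise `z`, as an element of `[0, ∞]`. -/
def truncatedRisk {n p : ℕ} (σ q : ℝ) (A : Set (Matrix (Fin n) (Fin p) ℝ))
    (est : Matrix (Fin n) (Fin p) ℝ → (Fin n → ℝ) → Fin p → ℝ) (β : Fin p → ℝ) : ℝ≥0∞ :=
  ∫⁻ d : Matrix (Fin n) (Fin p) ℝ × (Fin n → ℝ),
    A.indicator (fun X => ENNReal.ofReal (norm2 (est X (X *ᵥ β + d.2) - β) ^ q)) d.1
    ∂((designLaw n p).prod (noiseLaw n σ))

end SparseLasso

end

noncomputable section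

namespace SparseLasso

/-! ### Gaussian concentration for convex functions -/

section Concentration

variable {n : ℕ}

/-! Write the noise as `σ • w` with `w` standard Gaussian and fix a design `X` in the good event.
Call `w` tame if `σ/n ⟨w, Xv⟩ ≤ t ‖v‖₁ + a ‖v‖₂` for every `v`, where `t = (1 + δ₀) λ₀`, `a = √k λ₀`
and `λ₀ = σ √(2 log(p/k) / n)`. For `log(p/k) ≥ 3` the tame vectors form a closed convex set `K` of
Gaussian measure at least 1/2 (`half_le_stdGaussian_tameNoise`). The term `a ‖v‖₂` absorbs the few
columns exceeding the threshold, which is why `log(p/k)` suffices instead of `log p`.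

An arbitrary `w` is a tame `w₀` plus a remainder of length `d = dist(w, K)`. The Lasso basic
inequality and the restricted eigenvalue bound then give an error of at most a constant times `σ √(k
log(p/k) / n) (1 + d)²` (`lasso_error_le`, `error_bound_le`). Since `K` is convex with measure at
least 1/2, `E exp d` is bounded independently of the dimension (`lintegral_exp_infDist_le`), so all
moments of the error have the right order. Nothing here depends on `β`, and the bound is uniform
over good designs.

As `k/p → 0`, only finitely many problems have `log(p/k) < 3`; each of them gets its own finite
constant. -/

lemma map_inner_stdGaussian (v : EuclideanSpace ℝ (Fin n)) :
    (stdGaussian (EuclideanSpace ℝ (Fin n))).map (fun w => inner ℝ v w) =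
      gaussianReal 0 (‖v‖ ^ 2).toNNReal := by
  have h := IsGaussian.map_eq_gaussianReal (μ := stdGaussian (EuclideanSpace ℝ (Fin n)))
    (innerSL ℝ v)
  rw [integral_strongDual_stdGaussian, variance_dual_stdGaussian, innerSL_apply_norm] at h
  exact h

lemma lintegral_exp_inner (v : EuclideanSpace ℝ (Fin n)) :
    ∫⁻ w, ENNReal.ofReal (Real.exp (inner ℝ v w)) ∂stdGaussian (EuclideanSpace ℝ (Fin n)) =
      ENNReal.ofReal (Real.exp (‖v‖ ^ 2 / 2)) := by
  have hm : Measurable fun x : ℝ => ENNReal.ofReal (Real.exp x) := by fun_prop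
  rw [← lintegral_map (f := fun x : ℝ => ENNReal.ofReal (Real.exp x))
    (g := fun w => inner ℝ v w) hm (by fun_prop), map_inner_stdGaussian]
  have hi := integrable_exp_mul_gaussianReal (μ := 0) (v := (‖v‖ ^ 2).toNNReal) 1
  simp only [one_mul] at hi
  rw [← ofReal_integral_eq_lintegral_ofReal hi (ae_of_all _ fun x => (Real.exp_pos x).le)]
  have h := congrFun (mgf_fun_id_gaussianReal (μ := 0) (v := (‖v‖ ^ 2).toNNReal)) 1
  simp only [mgf, one_mul] at h
  rw [h]
  simp

/-- Fernique's theorem makes `exp (C ‖w‖²)` integrable for some `C > 0`, and completing the square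
dominates the linear exponent. -/
lemma integrable_exp_norm (c : ℝ) :
    Integrable (fun w => Real.exp (c * ‖w‖)) (stdGaussian (EuclideanSpace ℝ (Fin n))) := by
  obtain ⟨C, hC, hint⟩ := IsGaussian.exists_integrable_exp_sq
    (stdGaussian (EuclideanSpace ℝ (Fin n)))
  refine (hint.const_mul (Real.exp (c ^ 2 / (4 * C)))).mono' (by fun_prop) (ae_of_all _ fun w => ?_)
  rw [Real.norm_of_nonneg (Real.exp_pos _).le, ← Real.exp_add, Real.exp_le_exp]
  have : c ^ 2 / (4 * C) + C * ‖w‖ ^ 2 - c * ‖w‖ = (c - 2 * C * ‖w‖) ^ 2 / (4 * C) := by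
    field_simp
    ring
  have : 0 ≤ (c - 2 * C * ‖w‖) ^ 2 / (4 * C) := by positivity
  linarith

/-- Controls the second-order error of a small rotation: the integrals tend to 1 as the rotation is
subdivided, and 2 is just a convenient bound above 1. -/
lemma exists_lintegral_exp_norm_div_le_two (c : ℝ) :
    ∃ N : ℕ, ∫⁻ w, ENNReal.ofReal (Real.exp (c / ((N : ℝ) + 1) * ‖w‖))
      ∂stdGaussian (EuclideanSpace ℝ (Fin n)) ≤ 2 := by
  have h : Tendsto (fun N : ℕ => ∫⁻ w, ENNReal.ofReal (Real.exp (c / ((N : ℝ) + 1) * ‖w‖))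
      ∂stdGaussian (EuclideanSpace ℝ (Fin n))) atTop
      (𝓝 (∫⁻ _, 1 ∂stdGaussian (EuclideanSpace ℝ (Fin n)))) := by
    refine tendsto_lintegral_of_dominated_convergence
      (fun w => ENNReal.ofReal (Real.exp (|c| * ‖w‖))) (fun N => by fun_prop)
      (fun N => ae_of_all _ fun w => ?_) ?_ (ae_of_all _ fun w => ?_)
    · refine ENNReal.ofReal_le_ofReal (Real.exp_le_exp.2 ?_)
      gcongr
      refine (div_le_div_of_nonneg_right (le_abs_self c) (by positivity)).trans ?_
      exact div_le_self (abs_nonneg c) (by norm_num)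
    · exact ((integrable_exp_norm |c|).lintegral_lt_top).ne
    · have h0 : Tendsto (fun N : ℕ => c / ((N : ℝ) + 1) * ‖w‖) atTop (𝓝 (0 * ‖w‖)) := by
        refine Tendsto.mul_const _ ?_
        simpa [div_eq_mul_inv] using
          (tendsto_one_div_add_atTop_nhds_zero_nat (𝕜 := ℝ)).const_mul c
      have h1 := ENNReal.tendsto_ofReal ((Real.continuous_exp.tendsto _).comp h0)
      simpa using h1
  simp only [lintegral_const, measure_univ, one_mul] at h
  exact ((h.eventually (ge_mem_nhds (by norm_num : (1 : ℝ≥0∞) < 2))).exists)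

/-- One small rotation: the exponential moment of the scaled increment of a function with
subgradients in the unit ball. -/
lemma lintegral_exp_increment_le {F : EuclideanSpace ℝ (Fin n) → ℝ}
    (hsub : ∀ z, ∃ v : EuclideanSpace ℝ (Fin n), ‖v‖ ≤ 1 ∧
      ∀ z', F z - F z' ≤ inner ℝ v (z - z')) {m h : ℝ} (hm : 0 ≤ m) :
    ∫⁻ z : EuclideanSpace ℝ (Fin n) × EuclideanSpace ℝ (Fin n),
      ENNReal.ofReal (Real.exp (m * (F z.1 - F (Real.cos h • z.1 + Real.sin h • z.2))))
      ∂((stdGaussian (EuclideanSpace ℝ (Fin n))).prod (stdGaussian (EuclideanSpace ℝ (Fin n))))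
      ≤ ENNReal.ofReal (Real.exp ((m * h) ^ 2 / 2)) *
        ∫⁻ z, ENNReal.ofReal (Real.exp (m * h ^ 2 / 2 * ‖z‖))
          ∂stdGaussian (EuclideanSpace ℝ (Fin n)) := by
  refine (lintegral_prod_le _).trans ?_
  rw [← lintegral_const_mul _ (by fun_prop)]
  refine lintegral_mono fun z => ?_
  -- The subgradient depends on `z` alone, so the `z'`-integral is a Gaussian Laplace transform with
  -- parameter of order `m h`. The remaining drift `(1 - cos h) ⟨v, z⟩` is at most `h² ‖z‖ / 2`.
  obtain ⟨v, hv, hvF⟩ := hsub z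
  calc ∫⁻ z', ENNReal.ofReal
        (Real.exp (m * (F z - F (Real.cos h • z + Real.sin h • z'))))
        ∂stdGaussian (EuclideanSpace ℝ (Fin n))
      ≤ ∫⁻ z', ENNReal.ofReal (Real.exp (m * h ^ 2 / 2 * ‖z‖)) *
          ENNReal.ofReal (Real.exp (inner ℝ (-(m * Real.sin h) • v) z'))
        ∂stdGaussian (EuclideanSpace ℝ (Fin n)) := by
        refine lintegral_mono fun z' => ?_
        rw [← ENNReal.ofReal_mul (Real.exp_pos _).le, ← Real.exp_add]
        refine ENNReal.ofReal_le_ofReal (Real.exp_le_exp.2 ?_)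
        have h1 := hvF (Real.cos h • z + Real.sin h • z')
        have h2 : inner ℝ v (z - (Real.cos h • z + Real.sin h • z')) =
            (1 - Real.cos h) * inner ℝ v z - Real.sin h * inner ℝ v z' := by
          simp only [inner_sub_right, inner_add_right, inner_smul_right]
          ring
        have h3 : inner ℝ v z ≤ ‖z‖ := (real_inner_le_norm v z).trans
          (mul_le_of_le_one_left (norm_nonneg z) hv)
        have h4 : (1 - Real.cos h) * inner ℝ v z ≤ h ^ 2 / 2 * ‖z‖ := by
          have hc0 : 0 ≤ 1 - Real.cos h := by linarith [Real.cos_le_one h]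
          have hc1 : 1 - Real.cos h ≤ h ^ 2 / 2 := by
            linarith [Real.one_sub_sq_div_two_le_cos (x := h)]
          exact (mul_le_mul_of_nonneg_left h3 hc0).trans
            (mul_le_mul_of_nonneg_right hc1 (norm_nonneg z))
        rw [h2] at h1
        rw [real_inner_smul_left]
        nlinarith [mul_le_mul_of_nonneg_left (h1.trans (sub_le_sub_right h4 _)) hm]
    _ = ENNReal.ofReal (Real.exp (m * h ^ 2 / 2 * ‖z‖)) *
          ENNReal.ofReal (Real.exp (‖-(m * Real.sin h) • v‖ ^ 2 / 2)) := by
        rw [lintegral_const_mul _ (by fun_prop), lintegral_exp_inner]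
    _ ≤ _ := by
        rw [mul_comm]
        rw [norm_smul, norm_neg, Real.norm_eq_abs, abs_mul, abs_of_nonneg hm, ← sq_abs (m * h),
          abs_mul m h, abs_of_nonneg hm]
        have h5 : |Real.sin h| ≤ |h| := Real.abs_sin_le_abs
        have h6 : m * |Real.sin h| * ‖v‖ ≤ m * |h| * 1 := by gcongr
        rw [mul_one] at h6
        have h7 := pow_le_pow_left₀ (by positivity) h6 2
        exact mul_le_mul_left (ENNReal.ofReal_le_ofReal (Real.exp_le_exp.2 (by linarith))) _

/-- The Maurey–Pisier rotation argument for functions with subgradients in the unit ball. -/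
theorem lintegral_exp_sub_le {F : EuclideanSpace ℝ (Fin n) → ℝ} (hF : Measurable F)
    (hsub : ∀ z, ∃ v : EuclideanSpace ℝ (Fin n), ‖v‖ ≤ 1 ∧
      ∀ z', F z - F z' ≤ inner ℝ v (z - z')) :
    ∫⁻ z : EuclideanSpace ℝ (Fin n) × EuclideanSpace ℝ (Fin n),
      ENNReal.ofReal (Real.exp (F z.1 - F z.2))
      ∂((stdGaussian (EuclideanSpace ℝ (Fin n))).prod (stdGaussian (EuclideanSpace ℝ (Fin n))))
      ≤ 2 * ENNReal.ofReal (Real.exp (Real.pi ^ 2 / 8)) := by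
  set γ := stdGaussian (EuclideanSpace ℝ (Fin n)) with hγ
  obtain ⟨N, hN⟩ := exists_lintegral_exp_norm_div_le_two (n := n) (Real.pi ^ 2 / 8)
  set m : ℝ := (N : ℝ) + 1 with hm
  have hm0 : 0 < m := by positivity
  -- `m` rotations by `h` make a quarter turn, carrying `z.1` to `z.2`. The factor `m` inside `G`
  -- prepares for Jensen's inequality applied to an average of `m` increments.
  set h : ℝ := Real.pi / (2 * m) with hh
  let G : EuclideanSpace ℝ (Fin n) × EuclideanSpace ℝ (Fin n) → ℝ≥0∞ := fun z =>
    ENNReal.ofReal (Real.exp (m * (F z.1 - F (Real.cos h • z.1 + Real.sin h • z.2))))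
  have hGm : Measurable G := by fun_prop
  have hG : ∫⁻ z, G z ∂(γ.prod γ) ≤ 2 * ENNReal.ofReal (Real.exp (Real.pi ^ 2 / 8)) := by
    refine (lintegral_exp_increment_le hsub hm0.le).trans ?_
    have e1 : (m * h) ^ 2 / 2 = Real.pi ^ 2 / 8 := by rw [hh]; field_simp; norm_num
    have e2 : m * h ^ 2 / 2 = Real.pi ^ 2 / 8 / m := by rw [hh]; field_simp; norm_num
    rw [mul_comm, e1, e2]
    exact mul_le_mul_left hN _
  let rot (i : ℕ) := ContinuousLinearMap.rotation (E := EuclideanSpace ℝ (Fin n)) ((i : ℝ) * h)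
  -- The product Gaussian law is rotation invariant, so every increment along the path has the same
  -- exponential moment as the first.
  have hrot (i : ℕ) : ∫⁻ z, G (rot i z) ∂(γ.prod γ) = ∫⁻ z, G z ∂(γ.prod γ) := by
    rw [← lintegral_map hGm (by fun_prop)]
    simp only [rot]
    rw [IsGaussian.map_rotation_eq_self (by simp [hγ])]
  let a (z : EuclideanSpace ℝ (Fin n) × EuclideanSpace ℝ (Fin n)) (i : ℕ) : ℝ :=
    F (Real.cos (i * h) • z.1 + Real.sin (i * h) • z.2)
  have hGa (z) (i : ℕ) : G (rot i z) = ENNReal.ofReal (Real.exp (m * (a z i - a z (i + 1)))) := by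
    simp only [G, rot, a, ContinuousLinearMap.rotation_apply]
    have : ((i + 1 : ℕ) : ℝ) * h = i * h + h := by push_cast; ring
    rw [this, Real.cos_add, Real.sin_add]
    congr 5
    module
  have hpt (z : EuclideanSpace ℝ (Fin n) × EuclideanSpace ℝ (Fin n)) :
      ENNReal.ofReal (Real.exp (F z.1 - F z.2)) ≤
        ∑ i ∈ Finset.range (N + 1), ENNReal.ofReal m⁻¹ * G (rot i z) := by
    have htel : ∑ i ∈ Finset.range (N + 1), (a z i - a z (i + 1)) = F z.1 - F z.2 := by
      rw [Finset.sum_range_sub']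
      have h1 : ((N + 1 : ℕ) : ℝ) * h = Real.pi / 2 := by
        push_cast
        rw [hh, ← hm]; field_simp
      simp [a, -Nat.cast_add, h1]
    have hj := convexOn_exp.map_sum_le (t := Finset.range (N + 1)) (w := fun _ => m⁻¹)
      (p := fun i => m * (a z i - a z (i + 1))) (fun _ _ => by positivity)
      (by simp [hm]; field_simp) (fun _ _ => Set.mem_univ _)
    simp only [smul_eq_mul, inv_mul_cancel_left₀ hm0.ne'] at hj
    rw [htel] at hj
    refine (ENNReal.ofReal_le_ofReal hj).trans ?_
    rw [ENNReal.ofReal_sum_of_nonneg (fun _ _ => by positivity)]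
    refine Finset.sum_le_sum fun i _ => ?_
    rw [ENNReal.ofReal_mul (by positivity), hGa]
  refine (lintegral_mono hpt).trans ?_
  rw [lintegral_finsetSum _ (fun i _ => by fun_prop)]
  simp_rw [lintegral_const_mul' _ _ ENNReal.ofReal_ne_top, hrot]
  rw [Finset.sum_const, Finset.card_range, nsmul_eq_mul, ← mul_assoc]
  have : ((N + 1 : ℕ) : ℝ≥0∞) * ENNReal.ofReal m⁻¹ = 1 := by
    rw [← ENNReal.ofReal_natCast, ← ENNReal.ofReal_mul (by positivity)]
    push_cast
    rw [← hm, mul_inv_cancel₀ hm0.ne', ENNReal.ofReal_one]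
  rw [this, one_mul]
  exact hG

/-- The distance to a closed convex set has a subgradient in the unit ball everywhere. -/
lemma exists_subgradient_infDist {K : Set (EuclideanSpace ℝ (Fin n))} (hne : K.Nonempty)
    (hcl : IsClosed K) (hconv : Convex ℝ K) (z : EuclideanSpace ℝ (Fin n)) :
    ∃ v : EuclideanSpace ℝ (Fin n), ‖v‖ ≤ 1 ∧
      ∀ z', Metric.infDist z K - Metric.infDist z' K ≤ inner ℝ v (z - z') := by
  obtain ⟨P, hPK, hP⟩ := exists_norm_eq_iInf_of_complete_convex hne hcl.isComplete hconv z
  have hproj := (norm_eq_iInf_iff_real_inner_le_zero hconv hPK).1 hP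
  have hd : Metric.infDist z K ≤ ‖z - P‖ := by
    rw [← dist_eq_norm]; exact Metric.infDist_le_dist_of_mem hPK
  by_cases h0 : ‖z - P‖ = 0
  · refine ⟨0, by simp, fun z' => ?_⟩
    rw [inner_zero_left]
    linarith [Metric.infDist_nonneg (x := z') (s := K)]
  -- Outside `K`, the subgradient is the unit outward normal at the projection `P`; `K` lies in the
  -- half-space behind it.
  refine ⟨‖z - P‖⁻¹ • (z - P), by simp [norm_smul, h0], fun z' => ?_⟩
  obtain ⟨Q, hQK, hQ⟩ := hcl.exists_infDist_eq_dist hne z'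
  have hpos : 0 < ‖z - P‖ := lt_of_le_of_ne (norm_nonneg _) (Ne.symm h0)
  have e1 : inner ℝ (z - P) (z - z') =
      ‖z - P‖ ^ 2 - inner ℝ (z - P) (Q - P) - inner ℝ (z - P) (z' - Q) := by
    rw [← real_inner_self_eq_norm_sq, ← inner_sub_right, ← inner_sub_right]
    congr 1; abel
  have e2 : inner ℝ (z - P) (z' - Q) ≤ ‖z - P‖ * ‖z' - Q‖ := real_inner_le_norm _ _
  rw [dist_eq_norm] at hQ
  rw [real_inner_smul_left, hQ, inv_mul_eq_div, le_div_iff₀ hpos]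
  nlinarith [hproj Q hQK]

/-- Restrict the second variable of the rotation bound to `K`, where the distance vanishes. This
costs only a factor `1 / γ(K) ≤ 2`. -/
theorem lintegral_exp_infDist_le {K : Set (EuclideanSpace ℝ (Fin n))}
    (hcl : IsClosed K) (hconv : Convex ℝ K)
    (hK : 1 / 2 ≤ stdGaussian (EuclideanSpace ℝ (Fin n)) K) :
    ∫⁻ z, ENNReal.ofReal (Real.exp (Metric.infDist z K))
      ∂stdGaussian (EuclideanSpace ℝ (Fin n)) ≤ 4 * ENNReal.ofReal (Real.exp (Real.pi ^ 2 / 8)) := by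
  set γ := stdGaussian (EuclideanSpace ℝ (Fin n)) with hγ
  have hne : K.Nonempty := by
    rw [Set.nonempty_iff_ne_empty]
    rintro rfl
    simp at hK
  have hm : Measurable fun z => Metric.infDist z K := (Metric.continuous_infDist_pt K).measurable
  have h := lintegral_exp_sub_le hm (exists_subgradient_infDist hne hcl hconv)
  rw [← hγ, lintegral_prod _ (by fun_prop)] at h
  have h1 : (∫⁻ z, ENNReal.ofReal (Real.exp (Metric.infDist z K)) ∂γ) * (1 / 2) ≤
      2 * ENNReal.ofReal (Real.exp (Real.pi ^ 2 / 8)) := by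
    refine le_trans ?_ h
    rw [← lintegral_mul_const _ (by fun_prop)]
    refine lintegral_mono fun z => ?_
    calc ENNReal.ofReal (Real.exp (Metric.infDist z K)) * (1 / 2)
        ≤ ENNReal.ofReal (Real.exp (Metric.infDist z K)) * γ K := by gcongr
      _ = ∫⁻ z' in K, ENNReal.ofReal (Real.exp (Metric.infDist z K)) ∂γ := by
          rw [setLIntegral_const]
      _ = ∫⁻ z' in K, ENNReal.ofReal
            (Real.exp (Metric.infDist z K - Metric.infDist z' K)) ∂γ := by
          refine setLIntegral_congr_fun hcl.measurableSet fun z' hz' => ?_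
          simp [Metric.infDist_zero_of_mem hz']
      _ ≤ _ := setLIntegral_le_lintegral _ _
  calc ∫⁻ z, ENNReal.ofReal (Real.exp (Metric.infDist z K)) ∂γ
      = (∫⁻ z, ENNReal.ofReal (Real.exp (Metric.infDist z K)) ∂γ) * (1 / 2) * 2 := by
        rw [mul_assoc, one_div, ENNReal.inv_mul_cancel (by norm_num) (by norm_num), mul_one]
    _ ≤ 2 * ENNReal.ofReal (Real.exp (Real.pi ^ 2 / 8)) * 2 := by gcongr
    _ = _ := by rw [mul_right_comm]; norm_num

end Concentration

/-! ### Deterministic analysis of the Lasso -/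

lemma norm2_nonneg {d : ℕ} (v : Fin d → ℝ) : 0 ≤ norm2 v := norm_nonneg _

lemma norm2_sq {d : ℕ} (v : Fin d → ℝ) : norm2 v ^ 2 = ∑ j, v j ^ 2 := by
  simp [norm2, EuclideanSpace.real_norm_sq_eq]

lemma norm2_eq_zero {d : ℕ} {v : Fin d → ℝ} : norm2 v = 0 ↔ v = 0 := by
  simp [norm2]

lemma norm1_nonneg {d : ℕ} (v : Fin d → ℝ) : 0 ≤ norm1 v :=
  Finset.sum_nonneg fun _ _ => abs_nonneg _

lemma sum_abs_le_sqrt_card_mul_norm2 {d : ℕ} (S : Finset (Fin d)) (v : Fin d → ℝ) :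
    ∑ j ∈ S, |v j| ≤ √(S.card : ℝ) * norm2 v := by
  refine le_of_pow_le_pow_left₀ two_ne_zero
    (mul_nonneg (Real.sqrt_nonneg _) (norm2_nonneg v)) ?_
  rw [mul_pow, Real.sq_sqrt (by positivity), norm2_sq]
  refine sq_sum_le_card_mul_sum_sq.trans ?_
  simp only [sq_abs]
  exact mul_le_mul_of_nonneg_left
    (Finset.sum_le_univ_sum_of_nonneg fun _ => sq_nonneg _) (by positivity)

/-- Off the support of `β` each term is exactly `-|bⱼ - βⱼ|`. On the support use the triangle
inequality, then Cauchy–Schwarz over at most `k` coordinates. -/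
lemma norm1_sub_norm1_le {p k : ℕ} {β : Fin p → ℝ} (hβ : β ∈ Theta p k) (b : Fin p → ℝ) :
    norm1 β - norm1 b ≤ 2 * (√(k : ℝ) * norm2 (b - β)) - norm1 (b - β) := by
  classical
  let S : Finset (Fin p) := Finset.univ.filter fun j => β j ≠ 0
  have hS : S.card ≤ k := by
    have h : (Function.support β).ncard ≤ k := hβ
    have e : Function.support β = (S : Set (Fin p)) := by ext; simp [S]
    rwa [e, Set.ncard_coe_finset] at h
  have h1 : ∑ j ∈ S, |(b - β) j| ≤ √(k : ℝ) * norm2 (b - β) := by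
    refine (sum_abs_le_sqrt_card_mul_norm2 S (b - β)).trans ?_
    have := norm2_nonneg (b - β)
    gcongr
  have h2 : norm1 β - norm1 b ≤ 2 * ∑ j ∈ S, |(b - β) j| - norm1 (b - β) := by
    simp only [norm1, S, Finset.sum_filter, Finset.mul_sum, ← Finset.sum_sub_distrib]
    refine Finset.sum_le_sum fun j _ => ?_
    by_cases hj : β j = 0
    · simp [hj]
    · simp only [hj, ne_eq, not_false_eq_true, if_true, Pi.sub_apply]
      linarith [abs_sub_abs_le_abs_sub (β j) (b j), abs_sub_comm (β j) (b j)]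
  linarith

lemma lasso_basic_inequality {n p : ℕ} {lam : ℝ} {X : Matrix (Fin n) (Fin p) ℝ}
    {β b : Fin p → ℝ} {z : EuclideanSpace ℝ (Fin n)}
    (hb : IsMinOn (lassoObjective lam X (X *ᵥ β + z.ofLp)) Set.univ b) :
    1 / (2 * (n : ℝ)) * norm2 (X *ᵥ (b - β)) ^ 2 ≤
      1 / (n : ℝ) * inner ℝ (WithLp.toLp 2 (X *ᵥ (b - β))) z + lam * (norm1 β - norm1 b) := by
  have h := hb (Set.mem_univ β)
  simp only [Set.mem_ofPred_eq, lassoObjective, add_sub_cancel_left] at h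
  have e : X *ᵥ β + z.ofLp - X *ᵥ b = z.ofLp - X *ᵥ (b - β) := by
    rw [Matrix.mulVec_sub]; abel
  have e2 : norm2 (z.ofLp - X *ᵥ (b - β)) ^ 2 = norm2 z.ofLp ^ 2 -
      2 * inner ℝ (WithLp.toLp 2 (X *ᵥ (b - β))) z + norm2 (X *ᵥ (b - β)) ^ 2 := by
    simp only [norm2, WithLp.toLp_sub, WithLp.toLp_ofLp]
    rw [norm_sub_sq_real, real_inner_comm]
  rw [e, e2] at h
  have e3 : 1 / (n : ℝ) * inner ℝ (WithLp.toLp 2 (X *ᵥ (b - β))) z =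
      1 / (2 * (n : ℝ)) * (2 * inner ℝ (WithLp.toLp 2 (X *ᵥ (b - β))) z) := by
    rw [mul_comm 2 (n : ℝ), ← div_div]; ring
  rw [e3]
  linarith

/-- The standardized noise vectors `w` for which `σ/n ⟨w, Xv⟩ ≤ t ‖v‖₁ + a ‖v‖₂` for all `v`. -/
def tameNoise {n p : ℕ} (σ t a : ℝ) (X : Matrix (Fin n) (Fin p) ℝ) :
    Set (EuclideanSpace ℝ (Fin n)) :=
  {w | ∀ v : Fin p → ℝ, σ / n * inner ℝ (WithLp.toLp 2 (X *ᵥ v)) w ≤ t * norm1 v + a * norm2 v}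

/-- The set is an intersection of closed half-spaces indexed by `v`. Its closedness and convexity
are what the distance estimate requires. -/
lemma isClosed_tameNoise {n p : ℕ} (σ t a : ℝ) (X : Matrix (Fin n) (Fin p) ℝ) :
    IsClosed (tameNoise σ t a X) := by
  simp only [tameNoise, Set.ofPred_forall]
  exact isClosed_iInter fun v => isClosed_le (by fun_prop) continuous_const

lemma convex_tameNoise {n p : ℕ} (σ t a : ℝ) (X : Matrix (Fin n) (Fin p) ℝ) :
    Convex ℝ (tameNoise σ t a X) := by
  intro w hw w' hw' r s hr hs hrs v
  rw [inner_add_right, inner_smul_right, inner_smul_right]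
  have h1 := mul_le_mul_of_nonneg_left (hw v) hr
  have h2 := mul_le_mul_of_nonneg_left (hw' v) hs
  have h3 : t * norm1 v + a * norm2 v =
      r * (t * norm1 v + a * norm2 v) + s * (t * norm1 v + a * norm2 v) := by
    rw [← add_mul, hrs, one_mul]
  rw [h3]
  linarith

lemma le_of_mem_goodDesign {n p k : ℕ} {δ₀ c₀ : ℝ} {X : Matrix (Fin n) (Fin p) ℝ} (hn : 1 ≤ n)
    (hX : X ∈ goodDesign n p k δ₀ c₀) {v : Fin p → ℝ}
    (hv : norm1 v ≤ (1 + c₀) * √(k : ℝ) * norm2 v) :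
    (1 - δ₀) * norm2 v ≤ norm2 (X *ᵥ v) / √(n : ℝ) := by
  have hn0 : 0 < √(n : ℝ) := Real.sqrt_pos.2 (by exact_mod_cast hn)
  by_cases h0 : v = 0
  · have : norm2 v = 0 := norm2_eq_zero.2 h0
    rw [this, mul_zero]
    exact div_nonneg (norm2_nonneg _) hn0.le
  have hpos : 0 < norm2 v := lt_of_le_of_ne (norm2_nonneg v) fun h => h0 (norm2_eq_zero.1 h.symm)
  have h1 : 1 - δ₀ ≤ norm2 (X *ᵥ v) / (√(n : ℝ) * norm2 v) := by
    refine hX.2.trans (csInf_le ⟨0, ?_⟩ ⟨v, ⟨hv, h0⟩, rfl⟩)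
    rintro _ ⟨u, -, rfl⟩
    exact div_nonneg (norm2_nonneg _) (mul_nonneg hn0.le (norm2_nonneg _))
  rw [le_div_iff₀ hn0]
  rw [le_div_iff₀ (by positivity)] at h1
  linarith

/-- The dichotomy behind the Lasso error bound: `D`, `N` and `x` stand for the `ℓ₂`, `ℓ₁` and
prediction norms of the error. -/
lemma error_le_of_dichotomy {D N x ρ H μ κ c θ : ℝ} (hD : 0 ≤ D) (hx : 0 ≤ x) (hρ : 0 ≤ ρ)
    (hH : 0 ≤ H) (hμ : 0 ≤ μ) (hκ : 0 < κ) (hθ : 0 < θ) (hN : 0 ≤ N)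
    (hgap : H + κ ≤ μ * c) (hbasic : x ^ 2 / 2 + μ * N ≤ H * D + ρ * x)
    (hcone : N ≤ c * D → θ * D ≤ x) :
    D ≤ 2 * H / θ ^ 2 + 2 * ρ / θ + ρ ^ 2 / (2 * κ) := by
  -- Inside the cone, `D ≤ x / θ` turns the basic inequality into a linear bound on `x`. Outside it,
  -- `μ N` absorbs `H D` with `κ D` to spare, and `ρ x - x² / 2 ≤ ρ² / 2`.
  by_cases h : N ≤ c * D
  · have h1 := hcone h
    have h2 : D ≤ x / θ := by rw [le_div_iff₀ hθ]; linarith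
    have h3 : x ≤ 2 * (H / θ + ρ) := by
      rcases hx.eq_or_lt with h0 | h0
      · rw [← h0]; positivity
      · have h4 : H * D ≤ H * (x / θ) := mul_le_mul_of_nonneg_left h2 hH
        have h5 : H * (x / θ) = H / θ * x := by ring
        have h6 : x * x ≤ 2 * (H / θ + ρ) * x := by nlinarith [mul_nonneg hμ hN]
        exact le_of_mul_le_mul_right h6 h0
    have h4 : x / θ ≤ 2 * (H / θ + ρ) / θ := by gcongr
    have h5 : 2 * (H / θ + ρ) / θ = 2 * H / θ ^ 2 + 2 * ρ / θ := by field_simp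
    have h6 : 0 ≤ ρ ^ 2 / (2 * κ) := by positivity
    linarith
  · push Not at h
    have h1 : μ * (c * D) ≤ μ * N := mul_le_mul_of_nonneg_left h.le hμ
    have h2 : (H + κ) * D ≤ μ * c * D := mul_le_mul_of_nonneg_right hgap hD
    have h3 : κ * D ≤ ρ ^ 2 / 2 := by nlinarith [sq_nonneg (x - ρ)]
    have h4 : D ≤ ρ ^ 2 / (2 * κ) := by
      rw [le_div_iff₀ (by positivity)]; linarith
    have h5 : 0 ≤ 2 * H / θ ^ 2 + 2 * ρ / θ := by positivity
    linarith

/-- Split the noise as `w₀ + (w - w₀)`. Tameness charges `w₀` to the `ℓ₁` and `ℓ₂` norms of the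
error, while Cauchy–Schwarz charges the remainder to the prediction norm. -/
theorem lasso_error_le {n p k : ℕ} {σ lam lam₀ t a δ₀ c₀ : ℝ} {X : Matrix (Fin n) (Fin p) ℝ}
    {β b : Fin p → ℝ} {w w₀ : EuclideanSpace ℝ (Fin n)} (hn : 1 ≤ n) (hk : 1 ≤ k) (hσ : 0 < σ)
    (hδ : δ₀ < 1) (hβ : β ∈ Theta p k) (hlam₀ : 0 < lam₀) (hlam0 : 0 ≤ lam) (hlam : lam ≤ 2 * lam₀)
    (ht : t ≤ lam) (ha : a ≤ √(k : ℝ) * lam₀)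
    (hgap : 2 * lam + 2 * lam₀ ≤ (lam - t) * (1 + c₀))
    (hX : X ∈ goodDesign n p k δ₀ c₀) (hw₀ : w₀ ∈ tameNoise σ t a X)
    (hb : IsMinOn (lassoObjective lam X (X *ᵥ β + (σ • w).ofLp)) Set.univ b) :
    norm2 (b - β) ≤ 10 * (√(k : ℝ) * lam₀) / (1 - δ₀) ^ 2 +
      2 * (σ * ‖w - w₀‖ / √(n : ℝ)) / (1 - δ₀) +
      (σ * ‖w - w₀‖ / √(n : ℝ)) ^ 2 / (2 * (√(k : ℝ) * lam₀)) := by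
  have hn0 : (0 : ℝ) < n := by exact_mod_cast hn
  have hs : 0 < √(n : ℝ) := Real.sqrt_pos.2 hn0
  have hk0 : 0 < √(k : ℝ) := Real.sqrt_pos.2 (by exact_mod_cast hk)
  have hss : √(n : ℝ) * √(n : ℝ) = n := Real.mul_self_sqrt hn0.le
  have hbasic := lasso_basic_inequality hb
  have hl1 := norm1_sub_norm1_le hβ b
  set Δ := b - β with hΔ
  have hD := norm2_nonneg Δ
  have hin : 1 / (n : ℝ) * inner ℝ (WithLp.toLp 2 (X *ᵥ Δ)) (σ • w) ≤
      t * norm1 Δ + a * norm2 Δ + σ * ‖w - w₀‖ / √(n : ℝ) * (norm2 (X *ᵥ Δ) / √(n : ℝ)) := by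
    have h1 := hw₀ Δ
    have h2 : inner ℝ (WithLp.toLp 2 (X *ᵥ Δ)) (w - w₀) ≤ norm2 (X *ᵥ Δ) * ‖w - w₀‖ :=
      real_inner_le_norm _ _
    have h3 : 1 / (n : ℝ) * inner ℝ (WithLp.toLp 2 (X *ᵥ Δ)) (σ • w) =
        σ / n * inner ℝ (WithLp.toLp 2 (X *ᵥ Δ)) w₀ +
          σ / n * inner ℝ (WithLp.toLp 2 (X *ᵥ Δ)) (w - w₀) := by
      rw [inner_smul_right, inner_sub_right]; ring
    have h4 : σ * ‖w - w₀‖ / √(n : ℝ) * (norm2 (X *ᵥ Δ) / √(n : ℝ)) =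
        σ / n * (norm2 (X *ᵥ Δ) * ‖w - w₀‖) := by
      rw [div_mul_div_comm, hss]; ring
    have h5 := mul_le_mul_of_nonneg_left h2 (div_pos hσ hn0).le
    rw [h3, h4]
    linarith
  have hx2 : 1 / (2 * (n : ℝ)) * norm2 (X *ᵥ Δ) ^ 2 = (norm2 (X *ᵥ Δ) / √(n : ℝ)) ^ 2 / 2 := by
    rw [div_pow, Real.sq_sqrt hn0.le]; field_simp
  have hmain : (norm2 (X *ᵥ Δ) / √(n : ℝ)) ^ 2 / 2 + (lam - t) * norm1 Δ ≤
      √(k : ℝ) * (2 * lam + lam₀) * norm2 Δ +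
        σ * ‖w - w₀‖ / √(n : ℝ) * (norm2 (X *ᵥ Δ) / √(n : ℝ)) := by
    have h1 := mul_le_mul_of_nonneg_left hl1 hlam0
    have h2 := mul_le_mul_of_nonneg_right ha hD
    rw [hx2] at hbasic
    linarith
  have hθ : 0 < 1 - δ₀ := by linarith
  refine (error_le_of_dichotomy (κ := √(k : ℝ) * lam₀) (c := (1 + c₀) * √(k : ℝ)) hD
    (div_nonneg (norm2_nonneg _) hs.le) (by positivity) (by positivity) (sub_nonneg.2 ht)
    (by positivity) hθ (norm1_nonneg Δ) ?_ hmain (le_of_mem_goodDesign hn hX)).trans ?_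
  · nlinarith [mul_le_mul_of_nonneg_left hgap hk0.le]
  -- The constant 10 is `2 (2 · 2 + 1)`, from `lam ≤ 2 * lam₀`.
  · have h1 : 2 * (√(k : ℝ) * (2 * lam + lam₀)) ≤ 10 * (√(k : ℝ) * lam₀) := by nlinarith
    gcongr

/-! ### The tame noise set has large Gaussian measure -/

lemma inner_mulVec_eq_sum {n p : ℕ} (X : Matrix (Fin n) (Fin p) ℝ) (v : Fin p → ℝ)
    (w : EuclideanSpace ℝ (Fin n)) :
    inner ℝ (WithLp.toLp 2 (X *ᵥ v)) w = ∑ j, v j * inner ℝ (WithLp.toLp 2 (X.col j)) w := by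
  simp only [PiLp.inner_apply, Matrix.mulVec, dotProduct, Matrix.col_apply, RCLike.inner_apply,
    conj_trivial, Finset.mul_sum]
  rw [Finset.sum_comm]
  refine Finset.sum_congr rfl fun j _ => Finset.sum_congr rfl fun i _ => ?_
  ring

/-- A Chernoff-type bound: use `u² / 2 ≤ exp u` at `u = c (|x| - t) ≥ 0`, then dominate `exp (c
|x|)` by the two signed exponentials. -/
lemma sq_max_abs_sub_le {c : ℝ} (hc : 0 < c) (t x : ℝ) :
    max (|x| - t) 0 ^ 2 ≤
      2 / c ^ 2 * Real.exp (-(c * t)) * (Real.exp (c * x) + Real.exp (-(c * x))) := by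
  rcases le_total (|x| - t) 0 with h | h
  · rw [max_eq_right h, zero_pow two_ne_zero]; positivity
  rw [max_eq_left h]
  have h1 := Real.quadratic_le_exp_of_nonneg (mul_nonneg hc.le h)
  have h2 : Real.exp (c * (|x| - t)) = Real.exp (-(c * t)) * Real.exp (c * |x|) := by
    rw [← Real.exp_add]; ring_nf
  have h3 : Real.exp (c * |x|) ≤ Real.exp (c * x) + Real.exp (-(c * x)) := by
    rcases abs_choice x with hx | hx <;> rw [hx]
    · linarith [Real.exp_pos (-(c * x))]
    · rw [mul_neg]; linarith [Real.exp_pos (c * x)]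
  have h4 : (c * (|x| - t)) ^ 2 / 2 ≤
      Real.exp (-(c * t)) * (Real.exp (c * x) + Real.exp (-(c * x))) := by
    have := mul_le_mul_of_nonneg_left h3 (Real.exp_pos (-(c * t))).le
    nlinarith [mul_nonneg hc.le h]
  calc (|x| - t) ^ 2 = 2 / c ^ 2 * ((c * (|x| - t)) ^ 2 / 2) := by field_simp
    _ ≤ 2 / c ^ 2 * (Real.exp (-(c * t)) * (Real.exp (c * x) + Real.exp (-(c * x)))) := by gcongr
    _ = _ := by ring

/-- Second moment of the excess of a Gaussian linear form over a threshold. -/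
lemma lintegral_sq_excess_le {n : ℕ} {v : EuclideanSpace ℝ (Fin n)} {S τ : ℝ} (hS : 0 < S)
    (hτ : 0 < τ) (hv : ‖v‖ ≤ S) :
    ∫⁻ w, ENNReal.ofReal (max (|inner ℝ v w| - S * τ) 0 ^ 2)
      ∂stdGaussian (EuclideanSpace ℝ (Fin n)) ≤
      ENNReal.ofReal (4 * S ^ 2 / τ ^ 2 * Real.exp (-(τ ^ 2 / 2))) := by
  -- This choice balances the exponents: `-c S τ + (c S)² / 2 = -τ² / 2`.
  set c := τ / S with hc
  have hc0 : 0 < c := by positivity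
  set A := 2 / c ^ 2 * Real.exp (-(c * (S * τ))) with hA
  have hA0 : 0 ≤ A := by positivity
  have hcv : ‖c • v‖ ≤ τ := by
    rw [norm_smul, Real.norm_of_nonneg hc0.le]
    calc c * ‖v‖ ≤ c * S := by gcongr
      _ = τ := by rw [hc]; field_simp
  have hpt (w : EuclideanSpace ℝ (Fin n)) :
      ENNReal.ofReal (max (|inner ℝ v w| - S * τ) 0 ^ 2) ≤ ENNReal.ofReal A *
        (ENNReal.ofReal (Real.exp (inner ℝ (c • v) w)) +
          ENNReal.ofReal (Real.exp (inner ℝ (-(c • v)) w))) := by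
    rw [← ENNReal.ofReal_add (Real.exp_pos _).le (Real.exp_pos _).le, ← ENNReal.ofReal_mul hA0,
      inner_neg_left, real_inner_smul_left]
    exact ENNReal.ofReal_le_ofReal (sq_max_abs_sub_le hc0 _ _)
  refine (lintegral_mono hpt).trans ?_
  rw [lintegral_const_mul _ (by fun_prop), lintegral_add_left (by fun_prop), lintegral_exp_inner,
    lintegral_exp_inner, norm_neg, ← ENNReal.ofReal_add (by positivity) (by positivity),
    ← ENNReal.ofReal_mul hA0]
  refine ENNReal.ofReal_le_ofReal ?_
  have h1 : Real.exp (‖c • v‖ ^ 2 / 2) ≤ Real.exp (τ ^ 2 / 2) := by gcongr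
  calc A * (Real.exp (‖c • v‖ ^ 2 / 2) + Real.exp (‖c • v‖ ^ 2 / 2))
      ≤ A * (Real.exp (τ ^ 2 / 2) + Real.exp (τ ^ 2 / 2)) := by gcongr
    _ = 4 / c ^ 2 * (Real.exp (-(c * (S * τ))) * Real.exp (τ ^ 2 / 2)) := by rw [hA]; ring
    _ = _ := by
        rw [← Real.exp_add]
        have e1 : -(c * (S * τ)) + τ ^ 2 / 2 = -(τ ^ 2 / 2) := by rw [hc]; field_simp; ring
        rw [e1, hc]; field_simp

/-- Bound `|gⱼ|` by `t` plus its excess over `t`. The threshold part pairs with `‖v‖₁`, and the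
excess vector pairs with `‖v‖₂` by Cauchy–Schwarz. -/
lemma mem_tameNoise_of_sum_sq_excess_le {n p : ℕ} {σ t a : ℝ} {X : Matrix (Fin n) (Fin p) ℝ}
    {w : EuclideanSpace ℝ (Fin n)} (ha : 0 ≤ a)
    (h : ∑ j, max (|inner ℝ ((σ / n) • WithLp.toLp 2 (X.col j)) w| - t) 0 ^ 2 ≤ a ^ 2) :
    w ∈ tameNoise σ t a X := by
  intro v
  rw [inner_mulVec_eq_sum, Finset.mul_sum]
  simp only [real_inner_smul_left] at h
  set g : Fin p → ℝ := fun j => σ / n * inner ℝ (WithLp.toLp 2 (X.col j)) w with hg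
  have h1 : ∑ j, |v j| * max (|g j| - t) 0 ≤ a * norm2 v := by
    refine (Real.sum_mul_le_sqrt_mul_sqrt _ _ _).trans ?_
    have e1 : √(∑ j, |v j| ^ 2) = norm2 v := by
      simp only [sq_abs]
      rw [← norm2_sq, Real.sqrt_sq (norm2_nonneg v)]
    have e2 : √(∑ j, max (|g j| - t) 0 ^ 2) ≤ a := Real.sqrt_le_iff.2 ⟨ha, h⟩
    rw [e1, mul_comm]
    exact mul_le_mul_of_nonneg_right e2 (norm2_nonneg v)
  refine le_trans ?_ (add_le_add_right h1 _)
  rw [norm1, Finset.mul_sum, ← Finset.sum_add_distrib]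
  refine Finset.sum_le_sum fun j _ => ?_
  have e : σ / n * (v j * inner ℝ (WithLp.toLp 2 (X.col j)) w) = v j * g j := by
    rw [hg]; ring
  rw [e]
  calc v j * g j ≤ |v j| * |g j| := by rw [← abs_mul]; exact le_abs_self _
    _ ≤ |v j| * (t + max (|g j| - t) 0) := by
        gcongr
        linarith [le_max_left (|g j| - t) 0]
    _ = _ := by ring

/-- With `τ² = 2 log(p/k)` the Gaussian factor `exp (-τ² / 2)` equals `k / p`. Summing over `p`
columns therefore leaves an expected squared excess of order `k σ² / (n log(p/k))`, and Markov's
inequality applies. -/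
theorem half_le_stdGaussian_tameNoise {n p k : ℕ} {σ s : ℝ} {X : Matrix (Fin n) (Fin p) ℝ}
    (hn : 1 ≤ n) (hk : 1 ≤ k) (hkp : k < p) (hσ : 0 < σ) (hs0 : 0 < s) (hs : s ≤ 3 / 2)
    (hlog : 3 ≤ Real.log ((p : ℝ) / k)) (hX : ∀ j, norm2 (X.col j) ≤ s * √(n : ℝ)) :
    1 / 2 ≤ stdGaussian (EuclideanSpace ℝ (Fin n))
      (tameNoise σ (s * (σ * √(2 * Real.log ((p : ℝ) / k) / n)))
        (√(k : ℝ) * (σ * √(2 * Real.log ((p : ℝ) / k) / n))) X) := by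
  set γ := stdGaussian (EuclideanSpace ℝ (Fin n)) with hγ
  set l := Real.log ((p : ℝ) / k) with hl
  have hn0 : (0 : ℝ) < n := by exact_mod_cast hn
  have hk0 : (0 : ℝ) < k := by exact_mod_cast hk
  have hp0 : (0 : ℝ) < p := by exact_mod_cast (by omega : 0 < p)
  set lam₀ := σ * √(2 * l / n) with hlam
  have hl0 : 0 < l := by linarith
  have hlam0 : 0 < lam₀ := by positivity
  have hlamsq : lam₀ ^ 2 = σ ^ 2 * (2 * l / n) := by
    rw [hlam, mul_pow, Real.sq_sqrt (by positivity)]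
  set S := s * σ / √(n : ℝ) with hS
  have hS0 : 0 < S := by positivity
  set τ := √(2 * l) with hτ
  have hτ0 : 0 < τ := by positivity
  have ht : s * lam₀ = S * τ := by
    rw [hlam, hS, hτ, Real.sqrt_div' _ hn0.le]; ring
  set a := √(k : ℝ) * lam₀ with ha
  have ha0 : 0 < a := by positivity
  let Q : EuclideanSpace ℝ (Fin n) → ℝ := fun w =>
    ∑ j, max (|inner ℝ ((σ / n) • WithLp.toLp 2 (X.col j)) w| - s * lam₀) 0 ^ 2
  have hQm : Measurable Q := by fun_prop
  have hQ : ∫⁻ w, ENNReal.ofReal (Q w) ∂γ ≤ ENNReal.ofReal (a ^ 2 / 2) := by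
    have h1 (j : Fin p) : ∫⁻ w, ENNReal.ofReal
        (max (|inner ℝ ((σ / n) • WithLp.toLp 2 (X.col j)) w| - s * lam₀) 0 ^ 2) ∂γ ≤
        ENNReal.ofReal (4 * S ^ 2 / τ ^ 2 * Real.exp (-(τ ^ 2 / 2))) := by
      rw [ht]
      refine lintegral_sq_excess_le hS0 hτ0 ?_
      rw [norm_smul, Real.norm_of_nonneg (by positivity)]
      calc σ / n * ‖WithLp.toLp 2 (X.col j)‖ ≤ σ / n * (s * √(n : ℝ)) := by
            gcongr
            exact hX j
        _ = S := by
            rw [hS, div_mul_eq_mul_div, div_eq_div_iff hn0.ne' (by positivity)]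
            have := Real.mul_self_sqrt hn0.le
            linear_combination σ * s * this
    simp only [Q]
    simp_rw [ENNReal.ofReal_sum_of_nonneg (fun _ _ => sq_nonneg _)]
    rw [lintegral_finsetSum _ (fun j _ => by fun_prop)]
    refine (Finset.sum_le_sum fun j _ => h1 j).trans ?_
    rw [Finset.sum_const, Finset.card_univ, Fintype.card_fin, nsmul_eq_mul,
      ← ENNReal.ofReal_natCast, ← ENNReal.ofReal_mul (by positivity)]
    refine ENNReal.ofReal_le_ofReal ?_
    have hτsq : τ ^ 2 = 2 * l := Real.sq_sqrt (by positivity)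
    have hexp : Real.exp (-(τ ^ 2 / 2)) = k / p := by
      rw [hτsq, mul_div_cancel_left₀ _ two_ne_zero, hl, Real.exp_neg,
        Real.exp_log (by positivity), inv_div]
    have hasq : a ^ 2 = k * (σ ^ 2 * (2 * l / n)) := by
      rw [ha, mul_pow, Real.sq_sqrt hk0.le, hlamsq]
    have hSsq : S ^ 2 = s ^ 2 * σ ^ 2 / n := by
      rw [hS, div_pow, Real.sq_sqrt hn0.le, mul_pow]
    rw [hexp, hτsq, hasq, hSsq]
    have e1 : (p : ℝ) * (4 * (s ^ 2 * σ ^ 2 / n) / (2 * l) * (k / p)) =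
        k * σ ^ 2 / n * (2 * s ^ 2 / l) := by field_simp; ring
    have e2 : k * (σ ^ 2 * (2 * l / n)) / 2 = k * σ ^ 2 / n * l := by field_simp
    rw [e1, e2]
    gcongr
    rw [div_le_iff₀ hl0]
    -- This is `2 s² ≤ l²`, which follows from `s ≤ 3/2` and `l ≥ 3`.
    nlinarith
  have hsub : {w | ENNReal.ofReal (a ^ 2) ≤ ENNReal.ofReal (Q w)}ᶜ ⊆ tameNoise σ (s * lam₀) a X := by
    intro w hw
    have h1 : ENNReal.ofReal (Q w) < ENNReal.ofReal (a ^ 2) := not_le.1 hw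
    exact mem_tameNoise_of_sum_sq_excess_le ha0.le
      ((ENNReal.ofReal_lt_ofReal_iff (by positivity)).1 h1).le
  have hmeas : MeasurableSet {w | ENNReal.ofReal (a ^ 2) ≤ ENNReal.ofReal (Q w)} :=
    measurableSet_le measurable_const (by fun_prop)
  refine le_trans ?_ (measure_mono hsub)
  have hM : γ {w | ENNReal.ofReal (a ^ 2) ≤ ENNReal.ofReal (Q w)} ≤ 1 / 2 := by
    have hne : ENNReal.ofReal (a ^ 2) ≠ 0 := by
      rw [ne_eq, ENNReal.ofReal_eq_zero, not_le]; positivity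
    refine (meas_ge_le_lintegral_div (by fun_prop) hne ENNReal.ofReal_ne_top).trans ?_
    rw [ENNReal.div_le_iff hne ENNReal.ofReal_ne_top]
    refine hQ.trans (le_of_eq ?_)
    rw [div_eq_mul_inv, mul_comm, ENNReal.ofReal_mul (by norm_num)]
    congr 1
    rw [ENNReal.ofReal_inv_of_pos two_pos]; simp
  rw [measure_compl hmeas (measure_ne_top _ _), measure_univ]
  calc (1 / 2 : ℝ≥0∞) = 1 - 1 / 2 := by simp
    _ ≤ _ := tsub_le_tsub_left hM 1

/-! ### Risk bounds -/

lemma noiseLaw_eq_map_stdGaussian (n : ℕ) (σ : ℝ) :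
    noiseLaw n σ =
      (stdGaussian (EuclideanSpace ℝ (Fin n))).map fun w => (σ • w).ofLp := by
  have h1 : noiseLaw n σ =
      (Measure.pi fun _ : Fin n => gaussianReal 0 1).map fun x i => σ * x i := by
    rw [Measure.pi_map_pi (fun _ => by fun_prop)]
    simp only [noiseLaw, gaussianReal_map_const_mul, mul_zero, mul_one]
    rfl
  rw [h1, ← map_pi_eq_stdGaussian, Measure.map_map (by fun_prop) (by fun_prop)]
  rfl

/-- Trades the polynomial moment for the available exponential moment; the exponent `d / (2q)` is
chosen so that raising to the power `2q` leaves exactly `exp d`. -/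
lemma one_add_rpow_le {q d : ℝ} (hq : 0 < q) (hd : 0 ≤ d) :
    ((1 + d) ^ 2) ^ q ≤ (2 * q + 1) ^ (2 * q) * Real.exp d := by
  have h1 : 1 + d ≤ (2 * q + 1) * Real.exp (d / (2 * q)) := by
    have h2 := Real.add_one_le_exp (d / (2 * q))
    calc 1 + d ≤ (2 * q + 1) * (d / (2 * q) + 1) := by
          have : (2 * q + 1) * (d / (2 * q) + 1) = 1 + d + (d / (2 * q) + 2 * q) := by
            field_simp; ring
          rw [this]
          have : 0 ≤ d / (2 * q) + 2 * q := by positivity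
          linarith
      _ ≤ _ := by gcongr
  calc ((1 + d) ^ 2) ^ q = (1 + d) ^ (2 * q) := by
        rw [← Real.rpow_natCast, ← Real.rpow_mul (by positivity)]; norm_num
    _ ≤ ((2 * q + 1) * Real.exp (d / (2 * q))) ^ (2 * q) := by gcongr
    _ = _ := by
        rw [Real.mul_rpow (by positivity) (Real.exp_pos _).le, ← Real.exp_mul]
        congr 2
        field_simp

/-- The constant in the pathwise error bound, as a function of the restricted eigenvalue `θ` and of
a lower bound `L` for `log (p / k)`. -/
def errorConst (θ L : ℝ) : ℝ := 15 / θ ^ 2 + 2 / (θ * √L) + 1 / L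

lemma errorConst_pos {θ L : ℝ} (hθ : 0 < θ) (hL : 0 < L) : 0 < errorConst θ L := by
  rw [errorConst]; positivity

/-- Since `k l ≥ L`, the remainder `σ d / √n` is at most the target rate times `d / √L`. Every term
is thus the rate times a polynomial of degree at most two in `d`. -/
lemma error_bound_le {σ k n l L θ d : ℝ} (hσ : 0 < σ) (hk : 1 ≤ k) (hn : 0 < n)
    (hL : 0 < L) (hl : L ≤ l) (hθ : 0 < θ) (hd : 0 ≤ d) :
    10 * (√k * (σ * √(2 * l / n))) / θ ^ 2 + 2 * (σ * d / √n) / θ +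
      (σ * d / √n) ^ 2 / (2 * (√k * (σ * √(2 * l / n)))) ≤
      σ * √(k * l / n) * (errorConst θ L * (1 + d) ^ 2) := by
  have hl0 : 0 < l := hL.trans_le hl
  have hk0 : 0 < k := by linarith
  set R := σ * √(k * l / n) with hR
  have hR0 : 0 < R := by positivity
  have e1 : √k * (σ * √(2 * l / n)) = √2 * R := by
    rw [hR, mul_div_assoc, mul_div_assoc, Real.sqrt_mul hk0.le, Real.sqrt_mul two_pos.le]; ring
  have h2 : √2 ≤ 3 / 2 := Real.sqrt_le_iff.2 ⟨by norm_num, by norm_num⟩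
  have h2' : 1 ≤ √2 := Real.one_le_sqrt.2 (by norm_num)
  set ρ := σ * d / √n with hρ
  have hρ0 : 0 ≤ ρ := by positivity
  have hρR : ρ ≤ R * (d / √L) := by
    have h3 : √L ≤ √(k * l) := Real.sqrt_le_sqrt (by nlinarith)
    have h4 : σ / √n ≤ R / √L := by
      rw [le_div_iff₀ (by positivity), hR, Real.sqrt_div' _ hn.le, div_mul_eq_mul_div,
        ← mul_div_assoc]
      gcongr
    calc ρ = σ / √n * d := by rw [hρ]; ring
      _ ≤ R / √L * d := by gcongr
      _ = _ := by ring
  have hsq : ρ ^ 2 / (2 * (√2 * R)) ≤ R * (d ^ 2 / L) := by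
    rw [div_le_iff₀ (by positivity)]
    have h5 : ρ ^ 2 ≤ (R * (d / √L)) ^ 2 := by gcongr
    have h6 : (R * (d / √L)) ^ 2 = R * (d ^ 2 / L) * R := by
      rw [mul_pow, div_pow, Real.sq_sqrt hL.le]; ring
    have h7 : R * (d ^ 2 / L) * R ≤ R * (d ^ 2 / L) * (2 * (√2 * R)) := by
      gcongr
      nlinarith
    linarith
  have hfirst : 10 * (√2 * R) / θ ^ 2 ≤ R * (15 / θ ^ 2) := by
    rw [← mul_div_assoc]
    exact div_le_div_of_nonneg_right (by nlinarith) (by positivity)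
  have hsecond : 2 * ρ / θ ≤ R * (2 / (θ * √L) * d) := by
    calc 2 * ρ / θ ≤ 2 * (R * (d / √L)) / θ := by gcongr
      _ = _ := by field_simp
  rw [e1]
  have h8 : 15 / θ ^ 2 + 2 / (θ * √L) * d + d ^ 2 / L ≤ errorConst θ L * (1 + d) ^ 2 := by
    have a1 : 0 < 15 / θ ^ 2 := by positivity
    have a2 : 0 < 2 / (θ * √L) := by positivity
    have a3 : 0 < 1 / L := by positivity
    have e2 : d ^ 2 / L = 1 / L * d ^ 2 := by ring
    rw [errorConst, e2]
    nlinarith [mul_nonneg a1.le hd, mul_nonneg a2.le hd, mul_nonneg a3.le hd,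
      mul_nonneg a1.le (sq_nonneg d), mul_nonneg a2.le (sq_nonneg d), mul_nonneg a3.le (sq_nonneg d)]
  have h9 := mul_le_mul_of_nonneg_left h8 hR0.le
  linarith

/-- The constant in the risk bound. -/
def riskConst (θ L q M : ℝ) : ℝ := errorConst θ L ^ q * (2 * q + 1) ^ (2 * q) * M

lemma riskConst_nonneg {θ L q M : ℝ} (hθ : 0 < θ) (hL : 0 < L) (hq : 0 < q) (hM : 0 ≤ M) :
    0 ≤ riskConst θ L q M := by
  have := errorConst_pos hθ hL
  rw [riskConst]; positivity

theorem truncatedRisk_le {n p k : ℕ} {σ ε t a δ₀ c₀ q L M : ℝ}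
    {est : Matrix (Fin n) (Fin p) ℝ → (Fin n → ℝ) → Fin p → ℝ} {β : Fin p → ℝ}
    (hn : 1 ≤ n) (hk : 1 ≤ k) (hσ : 0 < σ) (hε0 : 0 < ε) (hε1 : ε < 1)
    (hδ : δ₀ < 1) (hq : 0 < q) (hL : 0 < L) (hl : L ≤ Real.log ((p : ℝ) / k))
    (ht : t ≤ lamEps n p k σ ε)
    (ha : a ≤ √(k : ℝ) * (σ * √(2 * Real.log ((p : ℝ) / k) / n)))
    (hgap : 2 * lamEps n p k σ ε + 2 * (σ * √(2 * Real.log ((p : ℝ) / k) / n)) ≤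
      (lamEps n p k σ ε - t) * (1 + c₀))
    (hest : IsLassoEstimator (lamEps n p k σ ε) est) (hβ : β ∈ Theta p k)
    (hne : ∀ X ∈ goodDesign n p k δ₀ c₀, (tameNoise σ t a X).Nonempty)
    (hM : ∀ X ∈ goodDesign n p k δ₀ c₀,
      ∫⁻ w, ENNReal.ofReal (Real.exp (Metric.infDist w (tameNoise σ t a X)))
        ∂stdGaussian (EuclideanSpace ℝ (Fin n)) ≤ ENNReal.ofReal M) :
    truncatedRisk σ q (goodDesign n p k δ₀ c₀) est β ≤
      ENNReal.ofReal ((σ * √(k * Real.log ((p : ℝ) / k) / n)) ^ q *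
        riskConst (1 - δ₀) L q M) := by
  have hn0 : (0 : ℝ) < n := by exact_mod_cast hn
  have hk1 : (1 : ℝ) ≤ k := by exact_mod_cast hk
  have hl0 : 0 < Real.log ((p : ℝ) / k) := hL.trans_le hl
  have hθ : 0 < 1 - δ₀ := by linarith
  have hB := errorConst_pos hθ hL
  set R := σ * √(k * Real.log ((p : ℝ) / k) / n) with hR
  have hR0 : 0 < R := by positivity
  set A := R ^ q * (errorConst (1 - δ₀) L ^ q * (2 * q + 1) ^ (2 * q)) with hA
  have hA0 : 0 ≤ A := by positivity
  have hinner (X : Matrix (Fin n) (Fin p) ℝ) (hX : X ∈ goodDesign n p k δ₀ c₀) :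
      ∫⁻ z, ENNReal.ofReal (norm2 (est X (X *ᵥ β + z) - β) ^ q) ∂noiseLaw n σ ≤
        ENNReal.ofReal (A * M) := by
    rw [noiseLaw_eq_map_stdGaussian]
    refine (lintegral_map_le _ _).trans ?_
    rw [ENNReal.ofReal_mul hA0]
    refine le_trans ?_ (mul_le_mul_right (hM X hX) _)
    rw [← lintegral_const_mul' _ _ ENNReal.ofReal_ne_top]
    refine lintegral_mono fun w => ?_
    rw [← ENNReal.ofReal_mul hA0]
    refine ENNReal.ofReal_le_ofReal ?_
    obtain ⟨w₀, hw₀, hdist⟩ := (isClosed_tameNoise σ t a X).exists_infDist_eq_dist (hne X hX) w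
    have hlam : lamEps n p k σ ε = (1 + ε) * (σ * √(2 * Real.log ((p : ℝ) / k) / n)) := by
      rw [lamEps, mul_assoc]
    have hlam₀ : 0 < σ * √(2 * Real.log ((p : ℝ) / k) / n) := by positivity
    have h1 := lasso_error_le (w := w) hn hk hσ hδ hβ hlam₀ (by rw [hlam]; positivity)
      (by rw [hlam]; nlinarith) ht ha hgap hX hw₀ (hest.isMinOn X _)
    rw [← dist_eq_norm, ← hdist] at h1
    set d := Metric.infDist w (tameNoise σ t a X)
    have hd : 0 ≤ d := Metric.infDist_nonneg
    have h2 := h1.trans (error_bound_le hσ hk1 hn0 hL hl hθ hd)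
    calc _ ≤ (R * (errorConst (1 - δ₀) L * (1 + d) ^ 2)) ^ q :=
          Real.rpow_le_rpow (norm2_nonneg _) h2 hq.le
      _ = R ^ q * (errorConst (1 - δ₀) L ^ q * ((1 + d) ^ 2) ^ q) := by
          rw [Real.mul_rpow hR0.le (by positivity), Real.mul_rpow hB.le (by positivity)]
      _ ≤ R ^ q * (errorConst (1 - δ₀) L ^ q * ((2 * q + 1) ^ (2 * q) * Real.exp d)) := by
          gcongr
          exact one_add_rpow_le hq hd
      _ = A * Real.exp d := by rw [hA]; ring
  have : IsProbabilityMeasure (designLaw n p) := inferInstanceAs (IsProbabilityMeasure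
    (Measure.pi fun _ : Fin n => Measure.pi fun _ : Fin p => gaussianReal 0 1))
  refine (lintegral_prod_le _).trans ?_
  calc _ ≤ ∫⁻ _, ENNReal.ofReal (A * M) ∂designLaw n p := by
        refine lintegral_mono fun X => ?_
        by_cases hX : X ∈ goodDesign n p k δ₀ c₀
        · simpa [hX] using hinner X hX
        · simp [hX]
    _ = _ := by
        rw [lintegral_const, measure_univ, mul_one, hA, riskConst]
        congr 1
        ring

lemma rpow_two_div_mul {R W q : ℝ} (hR : 0 ≤ R) (hW : 0 ≤ W) (hq : 0 < q) :
    (R ^ q * W) ^ (2 / q) = W ^ (2 / q) * R ^ 2 := by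
  rw [Real.mul_rpow (by positivity) hW, ← Real.rpow_mul hR, mul_div_cancel₀ _ hq.ne', mul_comm]
  norm_num

lemma iSup_truncatedRisk_rpow_le {n p k : ℕ} {σ q W : ℝ} {A : Set (Matrix (Fin n) (Fin p) ℝ)}
    {est : Matrix (Fin n) (Fin p) ℝ → (Fin n → ℝ) → Fin p → ℝ} (hσ : 0 < σ) (hq : 0 < q)
    (hW : 0 ≤ W) (hl : 0 ≤ Real.log ((p : ℝ) / k))
    (h : ∀ β ∈ Theta p k, truncatedRisk σ q A est β ≤
      ENNReal.ofReal ((σ * √(k * Real.log ((p : ℝ) / k) / n)) ^ q * W)) :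
    (⨆ β ∈ Theta p k, truncatedRisk σ q A est β) ^ (2 / q) ≤
      ENNReal.ofReal (W ^ (2 / q) * (σ ^ 2 * (k : ℝ) * Real.log ((p : ℝ) / k) / n)) := by
  have h1 := ENNReal.rpow_le_rpow (iSup₂_le h) (by positivity : 0 ≤ 2 / q)
  rw [ENNReal.ofReal_rpow_of_nonneg (by positivity) (by positivity),
    rpow_two_div_mul (by positivity) hW hq, mul_pow, Real.sq_sqrt (by positivity)] at h1
  convert h1 using 4
  ring

/-! ### The constants `δ₀` and `c₀`, and uniformity along the sequence -/

lemma one_le_one_add_delta0 {ε : ℝ} (hε : 0 < ε) : 1 ≤ 1 + delta0 ε := by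
  rw [delta0, add_sub_cancel]
  exact Real.one_le_rpow (by linarith) (by norm_num)

lemma one_add_delta0_le {ε : ℝ} (hε : 0 < ε) : 1 + delta0 ε ≤ 1 + ε / 2 := by
  rw [delta0, add_sub_cancel]
  calc (1 + ε / 2) ^ (1 / 3 : ℝ) ≤ (1 + ε / 2) ^ (1 : ℝ) :=
        Real.rpow_le_rpow_of_exponent_le (by linarith) (by norm_num)
    _ = _ := Real.rpow_one _

lemma le_c0 {ε : ℝ} (hε : 0 < ε) : 10 / ε + 2 ≤ c0 ε := by
  have h1 : 1 ≤ √2 := Real.one_le_sqrt.2 (by norm_num)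
  have h2 : 1 ≤ (1 + ε / 2) ^ (2 / 3 : ℝ) := Real.one_le_rpow (by linarith) (by norm_num)
  have h3 : 8 * 1 * ε⁻¹ * 1 ≤ 8 * √2 * ε⁻¹ * (1 + ε / 2) ^ (2 / 3 : ℝ) := by gcongr
  rw [c0, div_eq_mul_inv]
  linarith

/-- The risk bound when `log (p / k) ≥ 3`, with a constant depending only on `ε` and `q`. -/
theorem iSup_truncatedRisk_le_of_three_le {n p k : ℕ} {σ ε q : ℝ}
    {est : Matrix (Fin n) (Fin p) ℝ → (Fin n → ℝ) → Fin p → ℝ}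
    (hn : 1 ≤ n) (hk : 1 ≤ k) (hkp : k < p) (hσ : 0 < σ) (hε0 : 0 < ε) (hε1 : ε < 1) (hq : 0 < q)
    (hl : 3 ≤ Real.log ((p : ℝ) / k)) (hest : IsLassoEstimator (lamEps n p k σ ε) est) :
    (⨆ β ∈ Theta p k,
      truncatedRisk σ q (goodDesign n p k (delta0 ε) (c0 ε)) est β) ^ (2 / q) ≤
      ENNReal.ofReal (riskConst (1 - delta0 ε) 3 q (4 * Real.exp (Real.pi ^ 2 / 8)) ^ (2 / q) *
        (σ ^ 2 * (k : ℝ) * Real.log ((p : ℝ) / k) / n)) := by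
  have hδ1 := one_le_one_add_delta0 hε0
  have hδ2 := one_add_delta0_le hε0
  have hc := le_c0 hε0
  have hn0 : (0 : ℝ) < n := by exact_mod_cast hn
  refine iSup_truncatedRisk_rpow_le hσ hq
    (riskConst_nonneg (by linarith) three_pos hq (by positivity)) (by linarith) fun β hβ => ?_
  set lam₀ := σ * √(2 * Real.log ((p : ℝ) / k) / n) with hlam₀
  have hlam0 : 0 < lam₀ := by positivity
  have hlam : lamEps n p k σ ε = (1 + ε) * lam₀ := by rw [lamEps, mul_assoc]
  have hhalf (X) (hX : X ∈ goodDesign n p k (delta0 ε) (c0 ε)) :=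
    half_le_stdGaussian_tameNoise hn hk hkp hσ (by linarith : 0 < 1 + delta0 ε) (by linarith) hl hX.1
  refine truncatedRisk_le (t := (1 + delta0 ε) * lam₀) (a := √(k : ℝ) * lam₀) hn hk hσ hε0 hε1
    (by linarith) hq three_pos hl ?_ le_rfl ?_ hest hβ (fun X hX => ?_) (fun X hX => ?_)
  · rw [hlam]
    gcongr
    linarith
  · rw [← hlam₀, hlam]
    have h1 : ε / 2 * lam₀ ≤ (1 + ε) * lam₀ - (1 + delta0 ε) * lam₀ := by nlinarith
    have h2 : 10 / ε + 3 ≤ 1 + c0 ε := by linarith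
    have h3 : ε / 2 * lam₀ * (10 / ε + 3) ≤
        ((1 + ε) * lam₀ - (1 + delta0 ε) * lam₀) * (1 + c0 ε) := by
      have : 0 ≤ 10 / ε + 3 := by positivity
      exact mul_le_mul h1 h2 this (le_trans (by positivity) h1)
    -- The gap condition needs `2 (1 + ε) + 2 = 4 + 2ε`, and `5 + 3ε/2` exceeds this for `ε < 1`.
    have h4 : ε / 2 * lam₀ * (10 / ε + 3) = (5 + 3 / 2 * ε) * lam₀ := by field_simp; ring
    nlinarith
  · rw [Set.nonempty_iff_ne_empty]
    intro h
    have := hhalf X hX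
    rw [h] at this
    simp at this
  · refine (lintegral_exp_infDist_le (isClosed_tameNoise _ _ _ X) (convex_tameNoise _ _ _ X)
      (hhalf X hX)).trans (le_of_eq ?_)
    rw [ENNReal.ofReal_mul (by norm_num)]
    simp

/-- For a single problem the truncated risk is bounded, with a constant depending on the problem. -/
theorem exists_iSup_truncatedRisk_le {n p k : ℕ} {σ ε q : ℝ}
    {est : Matrix (Fin n) (Fin p) ℝ → (Fin n → ℝ) → Fin p → ℝ}
    (hn : 1 ≤ n) (hk : 1 ≤ k) (hkp : k < p) (hσ : 0 < σ) (hε0 : 0 < ε) (hε1 : ε < 1) (hq : 0 < q)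
    (hest : IsLassoEstimator (lamEps n p k σ ε) est) :
    ∃ C : ℝ, (⨆ β ∈ Theta p k,
      truncatedRisk σ q (goodDesign n p k (delta0 ε) (c0 ε)) est β) ^ (2 / q) ≤
      ENNReal.ofReal (C * (σ ^ 2 * (k : ℝ) * Real.log ((p : ℝ) / k) / n)) := by
  have hδ2 := one_add_delta0_le hε0
  have hc := le_c0 hε0
  have hn0 : (0 : ℝ) < n := by exact_mod_cast hn
  have hk0 : (0 : ℝ) < k := by exact_mod_cast hk
  have hl : 0 < Real.log ((p : ℝ) / k) :=
    Real.log_pos ((one_lt_div hk0).2 (by exact_mod_cast hkp))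
  set M := ∫ w, Real.exp (1 * ‖w‖) ∂stdGaussian (EuclideanSpace ℝ (Fin n)) with hM
  have hM0 : 0 ≤ M := integral_nonneg fun w => (Real.exp_pos _).le
  refine ⟨_, iSup_truncatedRisk_rpow_le hσ hq
    (riskConst_nonneg (θ := 1 - delta0 ε) (by linarith) hl hq hM0) hl.le fun β hβ => ?_⟩
  set lam₀ := σ * √(2 * Real.log ((p : ℝ) / k) / n) with hlam₀
  have hlam0 : 0 < lam₀ := by positivity
  have hlam : lamEps n p k σ ε = (1 + ε) * lam₀ := by rw [lamEps, mul_assoc]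
  -- With `t = a = 0` the tame set contains the origin, so the distance to it is at most `‖w‖`. The
  -- resulting constant `E exp ‖w‖` depends on `n`, which is harmless for a single problem.
  have hzero (X : Matrix (Fin n) (Fin p) ℝ) : (0 : EuclideanSpace ℝ (Fin n)) ∈ tameNoise σ 0 0 X :=
    fun v => by simp
  refine truncatedRisk_le (t := 0) (a := 0) hn hk hσ hε0 hε1
    (by linarith) hq hl le_rfl (by rw [hlam]; positivity) (by positivity) ?_ hest hβ
    (fun X _ => ⟨0, hzero X⟩) (fun X _ => ?_)
  · rw [← hlam₀, hlam, sub_zero]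
    have h1 : 2 ≤ c0 ε - 1 := by
      have : 10 ≤ 10 / ε := by rw [le_div_iff₀ hε0]; linarith
      linarith
    have h2 : (1 + ε) * lam₀ * 2 ≤ (1 + ε) * lam₀ * (c0 ε - 1) := by gcongr
    have h3 : lam₀ ≤ (1 + ε) * lam₀ := by nlinarith
    linarith
  · rw [hM, ofReal_integral_eq_lintegral_ofReal (integrable_exp_norm 1)
      (ae_of_all _ fun w => (Real.exp_pos _).le)]
    refine lintegral_mono fun w => ENNReal.ofReal_le_ofReal (Real.exp_le_exp.2 ?_)
    simpa using Metric.infDist_le_dist_of_mem (x := w) (hzero X)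

lemma tendsto_log_div_atTop {p k : ℕ → ℕ} (hk : ∀ m, 1 ≤ k m) (hkp : ∀ m, k m < p m)
    (hlim : Tendsto (fun m => (k m : ℝ) / (p m : ℝ)) atTop (𝓝 0)) :
    Tendsto (fun m => Real.log ((p m : ℝ) / k m)) atTop atTop := by
  have h1 : Tendsto (fun m => (k m : ℝ) / (p m : ℝ)) atTop (𝓝[>] 0) := by
    refine tendsto_nhdsWithin_iff.2 ⟨hlim, Eventually.of_forall fun m => ?_⟩
    have h2 : (0 : ℝ) < k m := by exact_mod_cast hk m
    have h3 : (0 : ℝ) < p m := by exact_mod_cast (Nat.zero_le _).trans_lt (hkp m)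
    exact div_pos h2 h3
  have h2 := Real.tendsto_log_atTop.comp (tendsto_inv_nhdsGT_zero.comp h1)
  refine h2.congr fun m => ?_
  simp

end SparseLasso

end

theorem proposition4p6 (n p k : ℕ → ℕ) (σ : ℕ → ℝ) (ε : ℝ)
    (hn : ∀ m, 1 ≤ n m) (hk : ∀ m, 1 ≤ k m) (hkp : ∀ m, k m < p m)
    (hlim : Tendsto (fun m => (k m : ℝ) / (p m : ℝ)) atTop (𝓝 0))
    (hσ : ∀ m, 0 < σ m) (hε0 : 0 < ε) (hε1 : ε < 1)
    (est : ∀ m, Matrix (Fin (n m)) (Fin (p m)) ℝ → (Fin (n m) → ℝ) → Fin (p m) → ℝ)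
    (hest : ∀ m, SparseLasso.IsLassoEstimator
      (SparseLasso.lamEps (n m) (p m) (k m) (σ m) ε) (est m)) :
    ∀ q : ℝ, 2 ≤ q → ∃ C : ℝ, ∀ m,
      (⨆ β ∈ SparseLasso.Theta (p m) (k m),
        SparseLasso.truncatedRisk (σ m) q
          (SparseLasso.goodDesign (n m) (p m) (k m) (SparseLasso.delta0 ε) (SparseLasso.c0 ε))
          (est m) β) ^ (2 / q)
        ≤ ENNReal.ofReal
            (C * (σ m ^ 2 * (k m : ℝ) * Real.log ((p m : ℝ) / (k m : ℝ)) / (n m : ℝ))) := by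
  intro q hq
  have hq0 : 0 < q := by linarith
  obtain ⟨N, hN⟩ := eventually_atTop.1
    ((SparseLasso.tendsto_log_div_atTop hk hkp hlim).eventually_ge_atTop 3)
  choose C hC using fun m => SparseLasso.exists_iSup_truncatedRisk_le (hn m) (hk m) (hkp m) (hσ m)
    hε0 hε1 hq0 (hest m)
  set C₁ := SparseLasso.riskConst (1 - SparseLasso.delta0 ε) 3 q
    (4 * Real.exp (Real.pi ^ 2 / 8)) ^ (2 / q)
  have hrate (m : ℕ) :
      0 ≤ σ m ^ 2 * (k m : ℝ) * Real.log ((p m : ℝ) / (k m : ℝ)) / (n m : ℝ) := by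
    have hk0 : (0 : ℝ) < k m := by exact_mod_cast hk m
    have hl : 0 < Real.log ((p m : ℝ) / k m) :=
      Real.log_pos ((one_lt_div hk0).2 (by exact_mod_cast hkp m))
    positivity
  have hsum : 0 ≤ ∑ i ∈ Finset.range N, |C i| := Finset.sum_nonneg fun _ _ => abs_nonneg _
  -- `C₁` serves all `m ≥ N`, where `log(p/k) ≥ 3`; the finite sum dominates the individual
  -- constants of the earlier problems.
  refine ⟨|C₁| + ∑ i ∈ Finset.range N, |C i|, fun m => ?_⟩
  rcases le_or_gt N m with h | h
  · refine (SparseLasso.iSup_truncatedRisk_le_of_three_le (hn m) (hk m) (hkp m) (hσ m) hε0 hε1 hq0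
      (hN m h) (hest m)).trans (ENNReal.ofReal_le_ofReal ?_)
    exact mul_le_mul_of_nonneg_right (by linarith [le_abs_self C₁]) (hrate m)
  · refine (hC m).trans (ENNReal.ofReal_le_ofReal
      (mul_le_mul_of_nonneg_right ?_ (hrate m)))
    have := Finset.single_le_sum (f := fun i => |C i|) (fun _ _ => abs_nonneg _)
      (Finset.mem_range.2 h)
    linarith [le_abs_self (C m), abs_nonneg C₁]
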